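/- Let $p$ be a prime number, $R$ a commutative ring of characteristic $p$, and $n\in\mathbb{N}=\{0,1,2,\dots\}$. Let $A=A_n(R)$ be the $n$-th Weyl algebra over $R$, that is, the $R$-algebra generated by $x_1,\dots,x_n,\partial_1,\dots,\partial_n$ with the relations $[x_i,x_j]=0$, $[\partial_i,\partial_j]=0$, $[\partial_i,x_j]=\delta_{ij}$ for $i,j=1,\dots,n$, where $[a,b]=ab-ba$. Let $$C=R[x_1^p,\dots,x_n^p,\partial_1^p,\dots,\partial_n^p]\subset A$$ be the $R$-subalgebra generated by the elements $x_i^p$ and $\partial_i^p$ (which are central in $A$). Then: (i) The center of $A$ is equal to $C$. (ii) If $Q_1,\dots,Q_n,P_1,\dots,P_n\in A$ satisfy $[Q_i,Q_j]=0$, $[P_i,P_j]=0$ and $[P_i,Q_j]=\delta_{ij}$ for all $i,j=1,\dots,n$, then the family $$\{Q^\alpha P^\beta \mid \alpha,\beta\in\mathbb{N}^n,\ 0\le\alpha_i,\beta_i\le p-1 \text{ for all } i\},$$ where $Q^\alpha=Q_1^{\alpha_1}\cdots Q_n^{\alpha_n}$ and $P^\beta=P_1^{\beta_1}\cdots P_n^{\beta_n}$,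 is a basis of $A$ as a module over $C$. (iii) $A$ is an Azumaya algebra over $C$: it is a finitely generated, projective and faithful $C$-module, and the map $A\otimes_C A^{\mathrm{op}}\to\operatorname{End}_C(A)$, $a\otimes b\mapsto(x\mapsto axb)$, is an isomorphism. Moreover, the functor $F(N)=N\otimes_C A$, where $A$ acts by $a(n\otimes b)a'=n\otimes aba'$, is an equivalence from the category of $C$-modules to the category of $C$-linear $A$-bimodules (the $A$-bimodules $M$ with $rm=mr$ for all $r\in C$ and $m\in M$), with inverse $$G(M)=M^A=\{m\in M\mid am=ma \text{ for all } a\in A\}.$$ This equivalence preserves finite generation in both directions: a $C$-module $N$ is finitely generated if and only if $F(N)$ is a finitely generated $A$-bimodule, and a $C$-linear $A$-bimodule $M$ is finitely generated (as a bimodule) if and only if $G(M)$ is a finitely generated $C$-module. -/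

import Mathlib

open CategoryTheory MulOpposite
open scoped TensorProduct

universe u v w

noncomputable section

/-! ### The Weyl algebra -/

/-- The defining relations of the `n`-th Weyl algebra, on the free algebra on the letters
`inl i` (standing for `x i`) and `inr i` (standing for `∂ i`). -/
inductive WeylAlgebra.Rel (R : Type u) [CommRing R] (n : ℕ) :
    FreeAlgebra R (Fin n ⊕ Fin n) → FreeAlgebra R (Fin n ⊕ Fin n) → Prop
  | x_x (i j : Fin n) : WeylAlgebra.Rel R n
      ⁅(FreeAlgebra.ι R (Sum.inl i) : FreeAlgebra R (Fin n ⊕ Fin n)),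
        (FreeAlgebra.ι R (Sum.inl j) : FreeAlgebra R (Fin n ⊕ Fin n))⁆ 0
  | d_d (i j : Fin n) : WeylAlgebra.Rel R n
      ⁅(FreeAlgebra.ι R (Sum.inr i) : FreeAlgebra R (Fin n ⊕ Fin n)),
        (FreeAlgebra.ι R (Sum.inr j) : FreeAlgebra R (Fin n ⊕ Fin n))⁆ 0
  | d_x (i j : Fin n) : WeylAlgebra.Rel R n
      ⁅(FreeAlgebra.ι R (Sum.inr i) : FreeAlgebra R (Fin n ⊕ Fin n)),
        (FreeAlgebra.ι R (Sum.inl j) : FreeAlgebra R (Fin n ⊕ Fin n))⁆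
      (if i = j then 1 else 0)

/-- The `n`-th Weyl algebra `A_n(R)` over the commutative ring `R`. -/
abbrev WeylAlgebra (R : Type u) [CommRing R] (n : ℕ) : Type u :=
  RingQuot (WeylAlgebra.Rel R n)

/-- `(Q, P)` satisfies the commutation relations of the `n`-th Weyl algebra. -/
structure IsWeylTuple {A : Type u} [Ring A] {n : ℕ} (Q P : Fin n → A) : Prop where
  q_q : ∀ i j, ⁅Q i, Q j⁆ = 0
  p_p : ∀ i j, ⁅P i, P j⁆ = 0
  p_q : ∀ i j, ⁅P i, Q j⁆ = if i = j then 1 else 0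

/-- The ordered monomial `a_1 ^ v_1 * ⋯ * a_n ^ v_n`. -/
def tuplePow {A : Type u} [Ring A] {n : ℕ} (a : Fin n → A) (v : Fin n → ℕ) : A :=
  (List.ofFn fun i => a i ^ v i).prod

namespace WeylAlgebra

/-- The generator `x i`. -/
def x (R : Type u) [CommRing R] {n : ℕ} (i : Fin n) : WeylAlgebra R n :=
  RingQuot.mkAlgHom R (Rel R n) (FreeAlgebra.ι R (Sum.inl i))

/-- The generator `∂ i`. -/
def d (R : Type u) [CommRing R] {n : ℕ} (i : Fin n) : WeylAlgebra R n :=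
  RingQuot.mkAlgHom R (Rel R n) (FreeAlgebra.ι R (Sum.inr i))

theorem isWeylTuple (R : Type u) [CommRing R] (n : ℕ) :
    IsWeylTuple (x R : Fin n → WeylAlgebra R n) (d R) where
  q_q i j := by
    have h := RingQuot.mkAlgHom_rel R (Rel.x_x (R := R) i j)
    simpa [Ring.lie_def, x] using h
  p_p i j := by
    have h := RingQuot.mkAlgHom_rel R (Rel.d_d (R := R) i j)
    simpa [Ring.lie_def, d] using h
  p_q i j := by
    have h := RingQuot.mkAlgHom_rel R (Rel.d_x (R := R) i j)
    split_ifs at h ⊢ with hij <;> simpa [Ring.lie_def, x, d] using h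

/-- The subalgebra `C = R[x_1 ^ p, …, x_n ^ p, ∂_1 ^ p, …, ∂_n ^ p]` of `A_n(R)`. -/
def pSubalgebra (R : Type u) [CommRing R] (n p : ℕ) : Subalgebra R (WeylAlgebra R n) :=
  Algebra.adjoin R
    (Set.range (fun i : Fin n => x R i ^ p) ∪ Set.range (fun i : Fin n => d R i ^ p))

theorem mul_pow_of_lie {A : Type u} [Ring A] {a b c : A} (h : a * b = b * a + c)
    (hc : Commute c b) (k : ℕ) : a * b ^ (k + 1) = b ^ (k + 1) * a + (k + 1 : ℕ) * (c * b ^ k) := by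
  induction k with
  | zero => simp [h]
  | succ k ih =>
    have hc' : b * (c * b ^ k) = c * b ^ (k + 1) := by
      rw [← mul_assoc, ← hc.eq, mul_assoc, ← pow_succ']
    have hn : b * (((k + 1 : ℕ) : A) * (c * b ^ k)) = ((k + 1 : ℕ) : A) * (c * b ^ (k + 1)) := by
      rw [← mul_assoc, ← (Nat.cast_commute (k + 1) b).eq, mul_assoc, hc']
    rw [pow_succ' b (k + 1), ← mul_assoc, h, add_mul, mul_assoc, ih, mul_add, hn, ← mul_assoc]
    push_cast
    ring_nf
    noncomm_ring

theorem commute_pow_char {A : Type u} [Ring A] {p : ℕ} (hp : (p : A) = 0) {a b c : A}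
    (h : ⁅a, b⁆ = c) (hc : Commute c b) : Commute a (b ^ p) := by
  rcases p with _ | k
  · simp
  · have h1 : a * b = b * a + c := by rw [← h, Ring.lie_def]; abel
    have h2 := mul_pow_of_lie h1 hc k
    rwa [hp, zero_mul, add_zero] at h2

theorem natCast_char (R : Type u) [CommRing R] (n p : ℕ) [CharP R p] :
    (p : WeylAlgebra R n) = 0 := by
  rw [← map_natCast (algebraMap R (WeylAlgebra R n)) p, CharP.cast_eq_zero, map_zero]

theorem adjoin_generators (R : Type u) [CommRing R] (n : ℕ) :
    Algebra.adjoin R (Set.range (x R : Fin n → WeylAlgebra R n) ∪ Set.range (d R)) = ⊤ := by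
  have h1 : (RingQuot.mkAlgHom R (Rel R n)).range = ⊤ :=
    (AlgHom.range_eq_top _).2 (RingQuot.mkAlgHom_surjective R (Rel R n))
  rw [← h1, ← Algebra.map_top, ← FreeAlgebra.adjoin_range_ι, AlgHom.map_adjoin]
  congr 1
  rw [← Set.range_comp, ← Set.Sum.elim_range]
  congr 1
  funext s
  rcases s with i | i <;> rfl

/-- In characteristic `p`, the elements of `C` are central; this makes `A_n(R)` a `C`-algebra. -/
theorem pSubalgebra_le_center (R : Type u) [CommRing R] (n p : ℕ) [CharP R p] :
    pSubalgebra R n p ≤ Subalgebra.center R (WeylAlgebra R n) := by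
  have hp := natCast_char R n p
  have hw := isWeylTuple R n
  have key : ∀ z : WeylAlgebra R n, (∀ i, Commute (x R i) z) → (∀ i, Commute (d R i) z) →
      z ∈ Subalgebra.center R (WeylAlgebra R n) := by
    intro z hx hd
    rw [Subalgebra.mem_center_iff]
    intro b
    have hb : b ∈ Algebra.adjoin R
        (Set.range (x R : Fin n → WeylAlgebra R n) ∪ Set.range (d R)) := by
      rw [adjoin_generators]; trivial
    have hle : Algebra.adjoin R
        (Set.range (x R : Fin n → WeylAlgebra R n) ∪ Set.range (d R)) ≤
        Subalgebra.centralizer R {z} := by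
      rw [Algebra.adjoin_le_iff]
      rintro _ (⟨i, rfl⟩ | ⟨i, rfl⟩) <;>
        simp only [SetLike.mem_coe, Subalgebra.mem_centralizer_iff, Set.mem_singleton_iff,
          forall_eq]
      · exact (hx i).symm
      · exact (hd i).symm
    exact ((Subalgebra.mem_centralizer_iff R).1 (hle hb) z rfl).symm
  rw [pSubalgebra, Algebra.adjoin_le_iff]
  have hite : ∀ (i j : Fin n) (b : WeylAlgebra R n), Commute (if i = j then 1 else 0) b := by
    intro i j b
    split_ifs
    · exact Commute.one_left b
    · exact Commute.zero_left b
  rintro _ (⟨j, rfl⟩ | ⟨j, rfl⟩)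
  · exact key _ (fun i => commute_pow_char hp (hw.q_q i j) (Commute.zero_left _))
      (fun i => commute_pow_char hp (hw.p_q i j) (hite i j _))
  · refine key _ (fun i => ?_) (fun i => commute_pow_char hp (hw.p_p i j) (Commute.zero_left _))
    refine commute_pow_char hp (c := -(if j = i then 1 else 0)) ?_ (hite j i _).neg_left
    rw [← hw.p_q j i, Ring.lie_def, Ring.lie_def, neg_sub]

theorem pSubalgebra_comm (R : Type u) [CommRing R] (n p : ℕ) [CharP R p]
    (c : pSubalgebra R n p) (a : WeylAlgebra R n) : (c : WeylAlgebra R n) * a = a * c :=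
  (Subalgebra.mem_center_iff.1 (pSubalgebra_le_center R n p c.2) a).symm

instance (R : Type u) [CommRing R] (n p : ℕ) [CharP R p] : CommRing (pSubalgebra R n p) :=
  { (pSubalgebra R n p).toRing with
    mul_comm := fun a b => Subtype.ext (pSubalgebra_comm R n p a b) }

instance (R : Type u) [CommRing R] (n p : ℕ) [CharP R p] :
    Algebra (pSubalgebra R n p) (WeylAlgebra R n) where
  smul c a := (c : WeylAlgebra R n) * a
  algebraMap := (pSubalgebra R n p).val.toRingHom
  commutes' c a := pSubalgebra_comm R n p c a
  smul_def' _ _ := rfl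

end WeylAlgebra

/-! ### `C`-linear `A`-bimodules, for an algebra `A` over a commutative ring `C` -/

/-- An `A`-bimodule `M` (a left and right `A`-module with `(a m) b = a (m b)`) that is `C`-linear,
that is, `c m = m c` for all `c` in `C`. The right action is a left action of `Aᵐᵒᵖ`:
`m b` is `op b • m`. -/
structure LinBimod (C : Type v) (A : Type u) [CommRing C] [Ring A] [Algebra C A] where
  carrier : Type w
  [addCommGroup : AddCommGroup carrier]
  [leftModule : Module A carrier]
  [rightModule : Module Aᵐᵒᵖ carrier]
  [smulCommClass : SMulCommClass A Aᵐᵒᵖ carrier]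
  central : ∀ (c : C) (m : carrier), algebraMap C A c • m = op (algebraMap C A c) • m

namespace LinBimod

instance (C : Type v) (A : Type u) [CommRing C] [Ring A] [Algebra C A] :
    CoeSort (LinBimod.{u, v, w} C A) (Type w) :=
  ⟨LinBimod.carrier⟩

attribute [instance] LinBimod.addCommGroup LinBimod.leftModule LinBimod.rightModule
  LinBimod.smulCommClass

/-- A homomorphism of bimodules. -/
@[ext]
structure Hom {C : Type v} {A : Type u} [CommRing C] [Ring A] [Algebra C A]
    (M N : LinBimod.{u, v, w} C A) where
  toAddMonoidHom : M →+ N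
  map_left : ∀ (a : A) (m : M), toAddMonoidHom (a • m) = a • toAddMonoidHom m
  map_right : ∀ (a : A) (m : M), toAddMonoidHom (op a • m) = op a • toAddMonoidHom m

instance (C : Type v) (A : Type u) [CommRing C] [Ring A] [Algebra C A] :
    Category (LinBimod.{u, v, w} C A) where
  Hom M N := Hom M N
  id M := ⟨AddMonoidHom.id M, fun _ _ => rfl, fun _ _ => rfl⟩
  comp f g := ⟨g.toAddMonoidHom.comp f.toAddMonoidHom,
    fun a m => by simp [f.map_left, g.map_left], fun a m => by simp [f.map_right, g.map_right]⟩

/-- Finite generation as a bimodule: every element is a finite sum of terms `a s b` with `a`, `b`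
in `A` and `s` in a fixed finite set. -/
def FG {C : Type v} {A : Type u} [CommRing C] [Ring A] [Algebra C A]
    (M : LinBimod.{u, v, w} C A) : Prop :=
  ∃ S : Finset M, AddSubgroup.closure {m : M | ∃ a b : A, ∃ s ∈ S, m = a • (op b • s)} = ⊤

/-- The left action of `A` on `N ⊗[C] A`, given by `a (n ⊗ b) = n ⊗ a b`. -/
abbrev tensorLeft (C : Type v) (A : Type u) [CommRing C] [Ring A] [Algebra C A]
    (N : Type w) [AddCommGroup N] [Module C N] : Module A (N ⊗[C] A) :=
  Module.compHom (N ⊗[C] A)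
    ((Module.End.lTensorAlgHom C A N).comp (Algebra.lmul C A)).toRingHom

/-- The right action of `A` on `N ⊗[C] A`, given by `(n ⊗ b) a = n ⊗ b a`. -/
abbrev tensorRight (C : Type v) (A : Type u) [CommRing C] [Ring A] [Algebra C A]
    (N : Type w) [AddCommGroup N] [Module C N] : Module Aᵐᵒᵖ (N ⊗[C] A) :=
  Module.compHom (N ⊗[C] A)
    ((Module.End.lTensorAlgHom C A N).comp (Algebra.lsmul C C A (A := Aᵐᵒᵖ))).toRingHom

/-- The bimodule `N ⊗[C] A`. -/
def tensorObj (C : Type v) (A : Type u) [CommRing C] [Ring A] [Algebra C A]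
    (N : Type w) [AddCommGroup N] [Module C N] : LinBimod.{u, v, max w u} C A :=
  letI := tensorLeft C A N
  letI := tensorRight C A N
  { carrier := N ⊗[C] A
    smulCommClass := ⟨fun a b t => by
      change (Algebra.lmul C A a).lTensor N ((Algebra.lsmul C C A b).lTensor N t) =
        (Algebra.lsmul C C A b).lTensor N ((Algebra.lmul C A a).lTensor N t)
      rw [← LinearMap.lTensor_comp_apply, ← LinearMap.lTensor_comp_apply]
      congr 2
      ext m
      simp [mul_assoc]⟩
    central := fun c t => by
      change (Algebra.lmul C A (algebraMap C A c)).lTensor N t =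
        (Algebra.lsmul C C A (op (algebraMap C A c))).lTensor N t
      congr 2
      ext m
      simp [Algebra.smul_def, Algebra.commutes c m] }

theorem tensorObj_smul_tmul (C : Type v) (A : Type u) [CommRing C] [Ring A] [Algebra C A]
    (N : Type w) [AddCommGroup N] [Module C N] (a b : A) (y : N) :
    (a • (show tensorObj C A N from y ⊗ₜ[C] b)) = (show tensorObj C A N from y ⊗ₜ[C] (a * b)) :=
  rfl

theorem tensorObj_op_smul_tmul (C : Type v) (A : Type u) [CommRing C] [Ring A] [Algebra C A]
    (N : Type w) [AddCommGroup N] [Module C N] (a b : A) (y : N) :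
    (op a • (show tensorObj C A N from y ⊗ₜ[C] b)) =
      (show tensorObj C A N from y ⊗ₜ[C] (b * a)) :=
  rfl

/-- The functor `N ↦ N ⊗[C] A` from `C`-modules to `C`-linear `A`-bimodules. -/
def tensorFunctor (C : Type v) (A : Type u) [CommRing C] [Ring A] [Algebra C A] :
    ModuleCat.{max u w} C ⥤ LinBimod.{u, v, max u w} C A where
  obj N := tensorObj.{u, v, max u w} C A N
  map {N N'} f :=
    { toAddMonoidHom := (f.hom.rTensor A).toAddMonoidHom
      map_left := fun a t => by
        exact LinearMap.congr_fun ((LinearMap.rTensor_comp_lTensor (f := f.hom)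
          (g := Algebra.lmul C A a)).trans (LinearMap.lTensor_comp_rTensor (f := f.hom)
          (g := Algebra.lmul C A a)).symm) t
      map_right := fun a t => by
        exact LinearMap.congr_fun ((LinearMap.rTensor_comp_lTensor (f := f.hom)
          (g := Algebra.lsmul C C A (op a))).trans (LinearMap.lTensor_comp_rTensor (f := f.hom)
          (g := Algebra.lsmul C C A (op a))).symm) t }
  map_id N := by
    apply Hom.ext
    ext t
    exact LinearMap.congr_fun (LinearMap.rTensor_id A N) t
  map_comp f g := by
    apply Hom.ext
    ext t
    exact LinearMap.congr_fun (LinearMap.rTensor_comp A g.hom f.hom) t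

/-- `M ^ A = {m | a m = m a for all a}`. -/
def invariants {C : Type v} {A : Type u} [CommRing C] [Ring A] [Algebra C A]
    (M : LinBimod.{u, v, w} C A) : AddSubgroup M where
  carrier := {m | ∀ a : A, a • m = op a • m}
  zero_mem' := fun a => by simp
  add_mem' := fun {m m'} hm hm' a => by rw [smul_add, smul_add, hm a, hm' a]
  neg_mem' := fun {m} hm a => by rw [smul_neg, smul_neg, hm a]

theorem algebraMap_smul_mem {C : Type v} {A : Type u} [CommRing C] [Ring A] [Algebra C A]
    (M : LinBimod.{u, v, w} C A) (c : C) {m : M} (hm : m ∈ M.invariants) :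
    algebraMap C A c • m ∈ M.invariants := fun a => by
  rw [← mul_smul, ← Algebra.commutes, mul_smul, hm a, smul_comm]

/-- The `C`-module structure of `M ^ A`. -/
instance {C : Type v} {A : Type u} [CommRing C] [Ring A] [Algebra C A]
    (M : LinBimod.{u, v, w} C A) : Module C M.invariants where
  smul c m := ⟨algebraMap C A c • (m : M), M.algebraMap_smul_mem c m.2⟩
  one_smul m := Subtype.ext (by change algebraMap C A 1 • (m : M) = m; simp)
  mul_smul c c' m := Subtype.ext (by
    change algebraMap C A (c * c') • (m : M) = algebraMap C A c • (algebraMap C A c' • (m : M))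
    rw [map_mul, mul_smul])
  smul_zero c := Subtype.ext (by change algebraMap C A c • (0 : M) = 0; simp)
  smul_add c m m' := Subtype.ext (smul_add (algebraMap C A c) (m : M) (m' : M))
  add_smul c c' m := Subtype.ext (by
    change algebraMap C A (c + c') • (m : M) = algebraMap C A c • (m : M) + algebraMap C A c' • m
    rw [map_add, add_smul])
  zero_smul m := Subtype.ext (by change algebraMap C A 0 • (m : M) = 0; simp)

/-- The functor `M ↦ M ^ A` from `C`-linear `A`-bimodules to `C`-modules. -/
def invariantsFunctor (C : Type v) (A : Type u) [CommRing C] [Ring A] [Algebra C A] :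
    LinBimod.{u, v, w} C A ⥤ ModuleCat.{w} C where
  obj M := ModuleCat.of C M.invariants
  map {M M'} f := ModuleCat.ofHom
    { toFun := fun m => ⟨f.toAddMonoidHom m.1, fun a => by
        rw [← f.map_left, ← f.map_right, m.2 a]⟩
      map_add' := fun m m' => Subtype.ext (f.toAddMonoidHom.map_add m.1 m'.1)
      map_smul' := fun c m => Subtype.ext (f.map_left (algebraMap C A c) m.1) }
  map_id _ := rfl
  map_comp _ _ := rfl

end LinBimod

end

noncomputable section

/-! ### Ordered monomials -/

section TuplePow

variable {A : Type u} [Ring A] {n : ℕ} {a : Fin n → A}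

/-! For a Weyl tuple `(Q, P)`, the commutator with `P i` acts as differentiation in `Q i`, and the
commutator with `-Q i` as differentiation in `P i`. In characteristic `p` such operators isolate
each reduced monomial `w`: the Euler operator `Q i * [P i, ·]` has eigenvalues given by exponents,
Fermat's little theorem turns it into a projector, and `k!` is invertible for `k < p`. This yields
an operator `T_w`, built from left and right multiplications, sending `w` to `1` and the other
reduced monomials to `0` (`IsWeylTuple.exists_separating`).

Everything about `A` follows. The `T_w` give linear independence, and with a spanning argument the
standard monomials form a basis. An arbitrary tuple is not known to generate `A`, so its monomials
are compared with that basis by a determinant, a unit because independence persists over every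
residue field of `C`. Every endomorphism is `∑ w, f(w) T_w`, so `A ⊗ Aᵐᵒᵖ → End_C A` is onto, hence
bijective by ranks; the center is then `C`.

For bimodules, each functional `φ : A → C` gives an element of the enveloping algebra acting on `A`
as `y ↦ φ(y) 1`. Identities between such elements are checked on `A` and then hold on every
bimodule. Together with a retraction `A → C` they invert the unit and the counit. -/

theorem Commute.tuplePow_right {y : A} {v : Fin n → ℕ}
    (h : ∀ i, v i ≠ 0 → Commute y (a i)) : Commute y (tuplePow a v) := by
  refine Commute.list_prod_right _ _ fun z hz => ?_
  obtain ⟨i, rfl⟩ := (List.mem_ofFn' _ _).1 hz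
  by_cases hi : v i = 0
  · simp [hi]
  · exact (h i hi).pow_right _

theorem tuplePow_zero : tuplePow a 0 = 1 := by
  simp [tuplePow]

theorem tuplePow_succ {n : ℕ} (a : Fin (n + 1) → A) (v : Fin (n + 1) → ℕ) :
    tuplePow a v = a 0 ^ v 0 * tuplePow (fun i => a i.succ) (fun i => v i.succ) := by
  simp [tuplePow, List.ofFn_succ]

theorem tuplePow_add (ha : ∀ i j, Commute (a i) (a j)) (v w : Fin n → ℕ) :
    tuplePow a (v + w) = tuplePow a v * tuplePow a w := by
  induction n with
  | zero => simp [tuplePow]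
  | succ n ih =>
    have hc : Commute (a 0 ^ w 0) (tuplePow (fun i => a i.succ) (fun i => v i.succ)) :=
      Commute.tuplePow_right fun i _ => (ha _ _).pow_left _
    have hs := ih (a := fun i => a i.succ) (fun i j => ha _ _) (fun i => v i.succ)
      (fun i => w i.succ)
    rw [tuplePow_succ, tuplePow_succ a v, tuplePow_succ a w, Pi.add_apply, pow_add,
      show (fun i : Fin n => (v + w) i.succ) = (fun i => v i.succ) + (fun i => w i.succ) from rfl,
      hs, mul_assoc, mul_assoc, ← mul_assoc (tuplePow _ _) (a 0 ^ w 0), ← hc.eq, mul_assoc]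

theorem tuplePow_single (i : Fin n) (k : ℕ) : tuplePow a (Pi.single i k) = a i ^ k := by
  induction n with
  | zero => exact i.elim0
  | succ n ih =>
    rw [tuplePow_succ]
    induction i using Fin.cases with
    | zero =>
      rw [show (fun j : Fin n => (Pi.single 0 k : Fin (n + 1) → ℕ) j.succ) = 0 by
        funext j; simp, tuplePow_zero]
      simp
    | succ i =>
      rw [show (fun j : Fin n => (Pi.single i.succ k : Fin (n + 1) → ℕ) j.succ) =
        Pi.single i k by funext j; simp [Pi.single_apply], ih]
      simp

theorem tuplePow_eq_pow_mul (ha : ∀ i j, Commute (a i) (a j)) (v : Fin n → ℕ) (i : Fin n) :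
    tuplePow a v = a i ^ v i * tuplePow a (Function.update v i 0) := by
  rw [← tuplePow_single, ← tuplePow_add ha]
  congr 1
  funext j
  rcases eq_or_ne j i with rfl | h <;> simp [*]

theorem map_tuplePow {B : Type u} {F : Type w} [Ring B] [FunLike F A B] [MonoidHomClass F A B]
    (f : F) (v : Fin n → ℕ) : f (tuplePow a v) = tuplePow (fun i => f (a i)) v := by
  rw [tuplePow, map_list_prod, List.map_ofFn, tuplePow]
  congr 2
  funext i
  exact map_pow f _ _

theorem tuplePow_update (ha : ∀ i j, Commute (a i) (a j)) (v : Fin n → ℕ) (i : Fin n) (k : ℕ) :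
    tuplePow a (Function.update v i k) = a i ^ k * tuplePow a (Function.update v i 0) := by
  rw [tuplePow_eq_pow_mul ha _ i]
  simp

end TuplePow

/-! ### Consequences and transforms of the Weyl relations. -/

namespace IsWeylTuple

variable {A : Type u} [Ring A] {n : ℕ} {Q P : Fin n → A}

theorem commute_q (h : IsWeylTuple Q P) (i j : Fin n) : Commute (Q i) (Q j) :=
  commute_iff_lie_eq.2 (h.q_q i j)

theorem commute_p (h : IsWeylTuple Q P) (i j : Fin n) : Commute (P i) (P j) :=
  commute_iff_lie_eq.2 (h.p_p i j)

theorem commute_p_q (h : IsWeylTuple Q P) {i j : Fin n} (hij : i ≠ j) : Commute (P i) (Q j) :=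
  commute_iff_lie_eq.2 (by rw [h.p_q, if_neg hij])

theorem lie_self (h : IsWeylTuple Q P) (i : Fin n) : ⁅P i, Q i⁆ = 1 := by
  rw [h.p_q, if_pos rfl]

/-- The Fourier transform of a tuple satisfying the Weyl relations. -/
theorem fourier (h : IsWeylTuple Q P) : IsWeylTuple P (-Q) where
  q_q := h.p_p
  p_p i j := by simpa [Ring.lie_def] using h.q_q i j
  p_q i j := by
    have := h.p_q j i
    simp only [Ring.lie_def, Pi.neg_apply, eq_comm (a := i)] at this ⊢
    rw [← this]
    noncomm_ring

theorem map {B : Type u} [Ring B] (h : IsWeylTuple Q P) (f : A →+* B) :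
    IsWeylTuple (fun i => f (Q i)) (fun i => f (P i)) where
  q_q i j := by simpa [Ring.lie_def] using congrArg f (h.q_q i j)
  p_p i j := by simpa [Ring.lie_def] using congrArg f (h.p_p i j)
  p_q i j := by
    have := congrArg f (h.p_q i j)
    rw [apply_ite f] at this
    simpa [Ring.lie_def] using this

end IsWeylTuple

/-! ### Operators separating the reduced monomials -/

section Separating

variable {C : Type v} {B : Type u} [CommRing C] [Ring B] [Algebra C B]

theorem mulLeft_mem_range_mulLeftRight (a : B) :
    LinearMap.mulLeft C a ∈ (AlgHom.mulLeftRight C B).range :=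
  ⟨a ⊗ₜ 1, by ext; simp⟩

theorem mulRight_mem_range_mulLeftRight (a : B) :
    LinearMap.mulRight C a ∈ (AlgHom.mulLeftRight C B).range :=
  ⟨1 ⊗ₜ op a, by ext; simp⟩

theorem Module.End.pow_apply_of_eq_smul {M : Type w} [AddCommGroup M] [Module C M]
    {T : Module.End C M} {c : C} {y : M} (h : T y = c • y) (k : ℕ) : (T ^ k) y = c ^ k • y := by
  induction k with
  | zero => simp
  | succ k ih => rw [pow_succ', Module.End.mul_apply, ih, map_smul, h, smul_smul, pow_succ]

variable (C) in
/-- The inner derivation `y ↦ D y - y D`, as a `C`-linear map. -/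
def innerDer (D : B) : Module.End C B := LinearMap.mulLeft C D - LinearMap.mulRight C D

theorem innerDer_mem_range_mulLeftRight (D : B) :
    innerDer C D ∈ (AlgHom.mulLeftRight C B).range :=
  sub_mem (mulLeft_mem_range_mulLeftRight D) (mulRight_mem_range_mulLeftRight D)

/-- The derivation `[D, ·]` kills `z` and sends `X` to `1`, so it acts as `d/dX`. At `m = 0` the
truncated exponent is harmless, its coefficient being zero. -/
theorem innerDer_pow_mul {X D z : B} (h : ⁅D, X⁆ = 1) (hz : Commute D z) (m : ℕ) :
    innerDer C D (X ^ m * z) = (m : C) • (X ^ (m - 1) * z) := by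
  rcases m with _ | m
  · simp [innerDer, hz.eq]
  · have h1 : D * X = X * D + 1 := by rw [← h, Ring.lie_def]; abel
    have h2 := WeylAlgebra.mul_pow_of_lie h1 (Commute.one_left _) m
    simp only [innerDer, LinearMap.sub_apply, LinearMap.mulLeft_apply, LinearMap.mulRight_apply,
      Nat.add_sub_cancel, Algebra.smul_def, map_natCast]
    rw [← mul_assoc, h2, mul_assoc (X ^ (m + 1)) z D, ← hz.eq]
    noncomm_ring

theorem innerDer_pow_apply_pow_mul {X D z : B} (h : ⁅D, X⁆ = 1) (hz : Commute D z) (k : ℕ) :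
    (innerDer C D ^ k) (X ^ k * z) = (k.factorial : C) • z := by
  induction k with
  | zero => simp
  | succ k ih =>
    rw [pow_succ, Module.End.mul_apply, innerDer_pow_mul h hz, map_smul, Nat.add_sub_cancel, ih,
      smul_smul, Nat.factorial_succ, Nat.cast_mul]

theorem isUnit_cast_factorial {p : ℕ} (hp : p.Prime) (hC : (p : C) = 0) {k : ℕ} (hk : k < p) :
    IsUnit (k.factorial : C) := by
  have : Fact p.Prime := ⟨hp⟩
  have h : (k.factorial : ZMod p) ≠ 0 := by
    rw [Ne, ZMod.natCast_eq_zero_iff, hp.dvd_factorial]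
    omega
  simpa using h.isUnit.map (ZMod.castHom (ringChar.dvd hC) C)

/-- Fermat's little theorem in `ZMod p`, transported to `C`; it supplies the projector onto an
eigenspace of the Euler operator. -/
theorem one_sub_cast_sub_pow {p : ℕ} (hp : p.Prime) (hC : (p : C) = 0) {m k : ℕ} (hm : m < p)
    (hk : k < p) : 1 - ((m : C) - k) ^ (p - 1) = if m = k then 1 else 0 := by
  have : Fact p.Prime := ⟨hp⟩
  have h : 1 - ((m : ZMod p) - k) ^ (p - 1) = if m = k then 1 else 0 := by
    split_ifs with hmk
    · rw [hmk, sub_self, zero_pow (by have := hp.two_le; omega), sub_zero]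
    · rw [ZMod.pow_card_sub_one_eq_one, sub_self]
      rw [Ne, sub_eq_zero, ZMod.natCast_eq_natCast_iff, Nat.ModEq, Nat.mod_eq_of_lt hm,
        Nat.mod_eq_of_lt hk]
      exact hmk
  have := congrArg (ZMod.castHom (ringChar.dvd hC) C) h
  rw [apply_ite (ZMod.castHom (ringChar.dvd hC) C)] at this
  simpa only [map_sub, map_pow, map_one, map_natCast, map_zero] using this

/-- The Euler operator `E = X [D, ·]` has eigenvalue `m` on `X ^ m * z`, so `1 - (E - k) ^ (p - 1)`
keeps only `m = k`. Applying `[D, ·]` `k` times and dividing by `k!` then strips off `X ^ k`. -/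
theorem exists_separating_pow {p : ℕ} (hp : p.Prime) (hC : (p : C) = 0) {X D : B}
    (h : ⁅D, X⁆ = 1) {k : ℕ} (hk : k < p) :
    ∃ T ∈ (AlgHom.mulLeftRight C B).range, ∀ m < p, ∀ z, Commute D z →
      T (X ^ m * z) = if m = k then z else 0 := by
  obtain ⟨u, hu⟩ := isUnit_cast_factorial hp hC hk
  set E : Module.End C B := LinearMap.mulLeft C X * innerDer C D with hE
  refine ⟨(↑u⁻¹ : C) • (innerDer C D ^ k * (1 - (E - algebraMap C _ (k : C)) ^ (p - 1))),
    ?_, ?_⟩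
  · have hD := innerDer_mem_range_mulLeftRight (C := C) D
    exact Subalgebra.smul_mem _ (mul_mem (pow_mem hD _) (sub_mem (one_mem _) (pow_mem
      (sub_mem (mul_mem (mulLeft_mem_range_mulLeftRight X) hD) (Subalgebra.algebraMap_mem _ _))
      _))) _
  · intro m hm z hz
    have hEm : E (X ^ m * z) = (m : C) • (X ^ m * z) := by
      rw [hE, Module.End.mul_apply, innerDer_pow_mul h hz, map_smul, LinearMap.mulLeft_apply,
        ← mul_assoc, ← pow_succ']
      rcases m with _ | m
      · simp
      · rfl
    have hEk : (E - algebraMap C _ (k : C)) (X ^ m * z) = ((m : C) - k) • (X ^ m * z) := by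
      rw [LinearMap.sub_apply, hEm, Module.algebraMap_end_apply, sub_smul]
    rw [LinearMap.smul_apply, Module.End.mul_apply, LinearMap.sub_apply, Module.End.one_apply,
      Module.End.pow_apply_of_eq_smul hEk,
      show ∀ (c : C) (y : B), y - c • y = (1 - c) • y by simp [sub_smul], one_sub_cast_sub_pow hp hC hm hk]
    split_ifs with hmk
    · rw [hmk, one_smul, innerDer_pow_apply_pow_mul h hz, ← hu, smul_smul, Units.inv_mul, one_smul]
    · simp

/-- Variables are treated one at a time: those in `s` have already been compared with `w` and
removed. The factor `z` is a passive constant for every derivation `[P i, ·]`. -/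
theorem IsWeylTuple.exists_separating_tuplePow {p : ℕ} (hp : p.Prime) (hC : (p : C) = 0) {n : ℕ}
    {Q P : Fin n → B} (h : IsWeylTuple Q P) {w : Fin n → ℕ} (hw : ∀ i, w i < p)
    (s : Finset (Fin n)) :
    ∃ T ∈ (AlgHom.mulLeftRight C B).range, ∀ v : Fin n → ℕ, (∀ i, v i < p) →
      ∀ z, (∀ i, Commute (P i) z) → T (tuplePow Q v * z) =
        if ∀ i ∈ s, v i = w i then tuplePow Q (fun i => if i ∈ s then 0 else v i) * z else 0 := by
  induction s using Finset.induction_on with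
  | empty => exact ⟨1, one_mem _, by simp⟩
  | insert i s hi ih =>
    obtain ⟨T, hT, hTv⟩ := ih
    obtain ⟨T', hT', hTv'⟩ := exists_separating_pow (C := C) hp hC (h.lie_self i) (hw i)
    refine ⟨T' * T, mul_mem hT' hT, fun v hv z hz => ?_⟩
    rw [Module.End.mul_apply, hTv v hv z hz]
    by_cases hs : ∀ j ∈ s, v j = w j
    -- With `Q i` taken out, what remains involves only `Q j` with `j ≠ i`, so it is a constant for
    -- `[P i, ·]`.
    · have hc : Commute (P i)
          (tuplePow Q (Function.update (fun j => if j ∈ s then 0 else v j) i 0) * z) := by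
        refine (Commute.tuplePow_right fun j hj => h.commute_p_q ?_).mul_right (hz i)
        rintro rfl
        simp at hj
      rw [if_pos hs, tuplePow_eq_pow_mul h.commute_q _ i, mul_assoc, if_neg hi,
        hTv' _ (hv i) _ hc]
      have hu : Function.update (fun j => if j ∈ s then 0 else v j) i 0 =
          fun j => if j ∈ insert i s then 0 else v j := by
        funext j
        rcases eq_or_ne j i with rfl | hj <;> simp [*]
      rw [hu]
      exact if_congr (by rw [Finset.forall_mem_insert, and_iff_left hs]) rfl rfl
    · rw [if_neg hs, map_zero, if_neg]
      exact fun hs' => hs fun j hj => hs' j (Finset.mem_insert_of_mem hj)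

/-- The monomial `Q ^ α P ^ β` with exponents less than `p`. -/
def reducedMonomial {n : ℕ} (p : ℕ) (Q P : Fin n → B) (w : (Fin n → Fin p) × (Fin n → Fin p)) : B :=
  tuplePow Q (fun i => (w.1 i : ℕ)) * tuplePow P (fun i => (w.2 i : ℕ))

theorem IsWeylTuple.exists_separating {p : ℕ} (hp : p.Prime) (hC : (p : C) = 0) {n : ℕ}
    {Q P : Fin n → B} (h : IsWeylTuple Q P) (w : (Fin n → Fin p) × (Fin n → Fin p)) :
    ∃ T ∈ (AlgHom.mulLeftRight C B).range, ∀ v,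
      T (reducedMonomial p Q P v) = if v = w then 1 else 0 := by
  obtain ⟨S, hS, hSv⟩ := h.exists_separating_tuplePow (C := C) hp hC
    (w := fun i => w.1 i) (fun i => (w.1 i).2) Finset.univ
  -- `S` strips the `Q` part, with `P ^ β` as constant; `T` strips the `P` part by means of the
  -- derivations `[-Q i, ·]`, with constant `1`.
  obtain ⟨T, hT, hTv⟩ := h.fourier.exists_separating_tuplePow (C := C) hp hC
    (w := fun i => w.2 i) (fun i => (w.2 i).2) Finset.univ
  refine ⟨T * S, mul_mem hT hS, fun v => ?_⟩
  have hS' := hSv _ (fun i => (v.1 i).2) (tuplePow P fun i => (v.2 i : ℕ))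
    fun i => Commute.tuplePow_right fun j _ => h.commute_p i j
  have hT' := hTv _ (fun i => (v.2 i).2) 1 fun i => Commute.one_right _
  rw [mul_one] at hT'
  simp only [Finset.mem_univ, forall_const, if_true, ← Fin.ext_iff, ← funext_iff] at hS' hT'
  have hz (a : Fin n → B) : tuplePow a (fun _ => 0) = 1 := tuplePow_zero
  rw [hz, one_mul] at hS' hT'
  rw [Module.End.mul_apply, reducedMonomial, hS', apply_ite T, hT', map_zero, ← ite_and]
  simp only [Prod.ext_iff]

theorem IsWeylTuple.linearIndependent_reducedMonomial {p : ℕ} (hp : p.Prime) (hC : (p : C) = 0)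
    {n : ℕ} {Q P : Fin n → B} (h : IsWeylTuple Q P) (hB : Function.Injective (algebraMap C B)) :
    LinearIndependent C (reducedMonomial p Q P) := by
  rw [Fintype.linearIndependent_iff]
  intro g hg w
  obtain ⟨T, -, hT⟩ := h.exists_separating (C := C) hp hC w
  have := congrArg T hg
  simp only [map_sum, map_smul, hT, smul_ite, smul_zero, Finset.sum_ite_eq', Finset.mem_univ,
    if_true, map_zero, ← Algebra.algebraMap_eq_smul_one] at this
  exact hB (by rw [this, map_zero])

end Separating

/-! ### Bases of reduced monomials -/

section Span

variable {C : Type v} {B : Type u} [CommRing C] [Ring B] [Algebra C B] {n p : ℕ}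

theorem coe_update_fin (v : Fin n → Fin p) (i : Fin n) (k : Fin p) :
    (fun j => ((Function.update v i k : Fin n → Fin p) j : ℕ)) =
      Function.update (fun j => (v j : ℕ)) i k := by
  funext j
  rcases eq_or_ne j i with rfl | h <;> simp [*]

/-- The exponent of `a i` rises by one, or wraps from `p - 1` to `0` at the cost of the scalar `a i
^ p`. -/
theorem exists_mul_tuplePow_eq_smul {a : Fin n → B} (ha : ∀ i j, Commute (a i) (a j))
    (hap : ∀ i, a i ^ p ∈ (algebraMap C B).range) (v : Fin n → Fin p) (i : Fin n) :
    ∃ (c : C) (w : Fin n → Fin p),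
      a i * tuplePow a (fun j => (v j : ℕ)) = c • tuplePow a (fun j => (w j : ℕ)) := by
  rw [tuplePow_eq_pow_mul ha _ i, ← mul_assoc, ← pow_succ']
  by_cases h : (v i : ℕ) + 1 < p
  · refine ⟨1, Function.update v i ⟨v i + 1, h⟩, ?_⟩
    rw [one_smul, coe_update_fin]
    exact (tuplePow_update ha _ i _).symm
  · obtain ⟨c, hc⟩ := hap i
    have hv := (v i).2
    refine ⟨c, Function.update v i ⟨0, by omega⟩, ?_⟩
    rw [coe_update_fin, Algebra.smul_def, hc, show (v i : ℕ) + 1 = p by omega]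

/-- The span contains `1` and is stable under left multiplication by the generators, hence by all of
`B`. -/
theorem IsWeylTuple.span_reducedMonomial {Q P : Fin n → B} (h : IsWeylTuple Q P) (hp : 0 < p)
    (hQ : ∀ i, Q i ^ p ∈ (algebraMap C B).range) (hP : ∀ i, P i ^ p ∈ (algebraMap C B).range)
    (htop : Algebra.adjoin C (Set.range Q ∪ Set.range P) = ⊤) :
    Submodule.span C (Set.range (reducedMonomial p Q P)) = ⊤ := by
  set N := Submodule.span C (Set.range (reducedMonomial p Q P)) with hN
  have hmem (v) : reducedMonomial p Q P v ∈ N := Submodule.subset_span ⟨v, rfl⟩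
  have hlift (b : B) (hb : ∀ v, b * reducedMonomial p Q P v ∈ N) : ∀ y ∈ N, b * y ∈ N := by
    have : N ≤ N.comap (LinearMap.mulLeft C b) := by
      rw [hN, Submodule.span_le]
      rintro _ ⟨v, rfl⟩
      exact hb v
    exact this
  have hmul (b : B) : ∀ y ∈ N, b * y ∈ N := by
    have hb : b ∈ Algebra.adjoin C (Set.range Q ∪ Set.range P) := htop ▸ Algebra.mem_top
    induction hb using Algebra.adjoin_induction with
    | mem b hb =>
      refine hlift b ?_
      rintro ⟨α, β⟩
      rcases hb with ⟨i, rfl⟩ | ⟨i, rfl⟩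
      · obtain ⟨c, w, hw⟩ := exists_mul_tuplePow_eq_smul h.commute_q hQ α i
        rw [reducedMonomial, ← mul_assoc, hw, smul_mul_assoc]
        exact N.smul_mem c (hmem (w, β))
      · obtain ⟨c, w, hw⟩ := exists_mul_tuplePow_eq_smul h.commute_p hP β i
        have hc : Commute (P i) (tuplePow Q (Function.update (fun j => (α j : ℕ)) i 0) *
            tuplePow P fun j => (β j : ℕ)) := by
          refine (Commute.tuplePow_right fun j hj => h.commute_p_q ?_).mul_right
            (Commute.tuplePow_right fun j _ => h.commute_p i j)
          rintro rfl
          simp at hj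
        have hd := innerDer_pow_mul (C := C) (h.lie_self i) hc (α i)
        rw [← mul_assoc, ← tuplePow_eq_pow_mul h.commute_q (fun j => (α j : ℕ)), ← mul_assoc,
          ← tuplePow_update h.commute_q] at hd
        -- Moving `P i` past `Q ^ α` leaves a derivative term, which only lowers the exponent of `Q
        -- i`.
        have hsplit : P i * reducedMonomial p Q P (α, β) =
            innerDer C (P i) (reducedMonomial p Q P (α, β)) +
              tuplePow Q (fun j => (α j : ℕ)) * (P i * tuplePow P (fun j => (β j : ℕ))) := by
          rw [(Commute.tuplePow_right fun j _ => h.commute_p i j : Commute (P i) _).eq]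
          simp only [innerDer, LinearMap.sub_apply, LinearMap.mulLeft_apply,
            LinearMap.mulRight_apply, reducedMonomial, mul_assoc, sub_add_cancel]
        rw [hsplit]
        refine N.add_mem ?_ ?_
        · rw [reducedMonomial, hd]
          refine N.smul_mem _ ?_
          have hv : (α i : ℕ) - 1 < p := by omega
          rw [← coe_update_fin α i ⟨(α i : ℕ) - 1, hv⟩]
          exact hmem (_, β)
        · rw [hw, mul_smul_comm]
          exact N.smul_mem c (hmem (α, w))
    | algebraMap c => exact fun y hy => Algebra.smul_def c y ▸ N.smul_mem c hy
    | add b b' _ _ hb hb' => exact fun y hy => add_mul b b' y ▸ N.add_mem (hb y hy) (hb' y hy)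
    | mul b b' _ _ hb hb' => exact fun y hy => mul_assoc b b' y ▸ hb _ (hb' y hy)
  have h1 : (1 : B) ∈ N := by
    convert hmem (fun _ => ⟨0, hp⟩, fun _ => ⟨0, hp⟩)
    have hz (a : Fin n → B) : tuplePow a (fun _ => 0) = 1 := tuplePow_zero
    simp [reducedMonomial, hz]
  exact (Submodule.eq_top_iff').2 fun b => by simpa using hmul b 1 h1

end Span

/-! ### Arbitrary Weyl tuples and the Azumaya property. -/

section Basis

variable {C B : Type u} [CommRing C] [Ring B] [Algebra C B] {n p : ℕ}

theorem Module.Basis.det_baseChange_tmul {ι : Type w} [Fintype ι] [DecidableEq ι]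
    (e : Module.Basis ι C B) (K : Type v) [CommRing K] [Algebra C K] (f : ι → B) :
    (e.baseChange K).det (fun i => (1 : K) ⊗ₜ[C] f i) = algebraMap C K (e.det f) := by
  rw [Module.Basis.det_apply, Module.Basis.det_apply, RingHom.map_det]
  congr 1
  ext i j
  simp [Module.Basis.toMatrix_apply, Algebra.algebraMap_eq_smul_one]

/-- A nonunit determinant would vanish in some residue field `K` of `C`. The Weyl relations survive
base change, so over `K` the monomials are still independent; their number is the dimension, so the
determinant is nonzero there. -/
theorem IsWeylTuple.isUnit_det_reducedMonomial (hp : p.Prime) (hC : (p : C) = 0)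
    {Q P : Fin n → B} (h : IsWeylTuple Q P)
    (e : Module.Basis ((Fin n → Fin p) × (Fin n → Fin p)) C B) :
    IsUnit (e.det (reducedMonomial p Q P)) := by
  by_contra hu
  obtain ⟨m, hm, hdet⟩ := exists_max_ideal_of_mem_nonunits hu
  let := Ideal.Quotient.field m
  let K := C ⧸ m
  let b := e.baseChange K
  let f : B →+* K ⊗[C] B := (Algebra.TensorProduct.includeRight : B →ₐ[C] K ⊗[C] B)
  let w₀ : (Fin n → Fin p) × (Fin n → Fin p) := (fun _ => ⟨0, hp.pos⟩, fun _ => ⟨0, hp.pos⟩)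
  -- Nontriviality makes `K → K ⊗ B` injective, as independence over `K` requires.
  have : Nontrivial (K ⊗[C] B) := nontrivial_of_ne _ _ (b.ne_zero w₀)
  have hK : (p : K) = 0 := by rw [← map_natCast (algebraMap C K), hC, map_zero]
  have hli := (h.map f).linearIndependent_reducedMonomial (C := K) hp hK
    (algebraMap K (K ⊗[C] B)).injective
  have hfw : reducedMonomial p (fun i => f (Q i)) (fun i => f (P i)) =
      fun w => (1 : K) ⊗ₜ[C] reducedMonomial p Q P w := by
    funext w
    rw [reducedMonomial, ← map_tuplePow, ← map_tuplePow, ← map_mul]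
    rfl
  rw [hfw] at hli
  have : Module.Finite K (K ⊗[C] B) := .of_basis b
  have hunit := b.is_basis_iff_det.1
    ⟨hli, hli.span_eq_top_of_card_eq_finrank' (Module.finrank_eq_card_basis b).symm⟩
  rw [e.det_baseChange_tmul] at hunit
  exact hunit.ne_zero (Ideal.Quotient.eq_zero_iff_mem.2 hdet)

/-- The reduced monomials in any tuple satisfying the Weyl relations form a basis, as soon as the
algebra has a basis of the right cardinality. -/
def IsWeylTuple.basis (hp : p.Prime) (hC : (p : C) = 0) {Q P : Fin n → B} (h : IsWeylTuple Q P)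
    (e : Module.Basis ((Fin n → Fin p) × (Fin n → Fin p)) C B) :
    Module.Basis ((Fin n → Fin p) × (Fin n → Fin p)) C B :=
  have hb := e.is_basis_iff_det.2 (h.isUnit_det_reducedMonomial hp hC e)
  Module.Basis.mk hb.1 hb.2.ge

theorem IsWeylTuple.basis_apply (hp : p.Prime) (hC : (p : C) = 0) {Q P : Fin n → B}
    (h : IsWeylTuple Q P) (e : Module.Basis ((Fin n → Fin p) × (Fin n → Fin p)) C B)
    (w : (Fin n → Fin p) × (Fin n → Fin p)) : h.basis hp hC e w = reducedMonomial p Q P w := by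
  simp [IsWeylTuple.basis]

theorem IsWeylTuple.isAzumaya (hp : p.Prime) (hC : (p : C) = 0) {Q P : Fin n → B}
    (h : IsWeylTuple Q P) (hB : Function.Injective (algebraMap C B))
    (e : Module.Basis ((Fin n → Fin p) × (Fin n → Fin p)) C B)
    (he : ∀ w, e w = reducedMonomial p Q P w) : IsAzumaya C B := by
  have : Module.Free C B := .of_basis e
  have : Module.Finite C B := .of_basis e
  have : FaithfulSMul C B := (faithfulSMul_iff_algebraMap_injective C B).2 hB
  have : Module.Free C Bᵐᵒᵖ := .of_equiv (opLinearEquiv C)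
  have : Module.Finite C Bᵐᵒᵖ := .equiv (opLinearEquiv C)
  have hsurj : Function.Surjective (AlgHom.mulLeftRight C B) := by
    intro f
    rw [← AlgHom.mem_range]
    choose T hT hTv using fun w => h.exists_separating (C := C) hp hC w
    -- Both sides agree on the basis, since `T w` sends `e v` to `1` if `v = w` and to `0`
    -- otherwise.
    have hf : f = ∑ w, LinearMap.mulLeft C (f (e w)) * T w := e.ext fun v => by
      simp [LinearMap.sum_apply, he, hTv]
    rw [hf]
    exact sum_mem fun w _ => mul_mem (mulLeft_mem_range_mulLeftRight _) (hT w)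
  refine { bij := ⟨?_, hsurj⟩ }
  rcases subsingleton_or_nontrivial C with _ | _
  · have := Module.subsingleton C (B ⊗[C] Bᵐᵒᵖ)
    exact Function.injective_of_subsingleton _
  -- Equal ranks turn the surjection into a surjective endomorphism of a finite module, which is
  -- injective.
  obtain ⟨g⟩ := FiniteDimensional.nonempty_linearEquiv_of_finrank_eq (R := C) (M := Module.End C B)
    (M' := B ⊗[C] Bᵐᵒᵖ) (by
      rw [Module.finrank_linearMap, Module.finrank_tensorProduct,
        (opLinearEquiv C : B ≃ₗ[C] Bᵐᵒᵖ).finrank_eq])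
  have := OrzechProperty.injective_of_surjective_endomorphism
    (g.toLinearMap ∘ₗ (AlgHom.mulLeftRight C B).toLinearMap) (g.surjective.comp hsurj)
  exact Function.Injective.of_comp this

end Basis

/-! ### Bimodules over an Azumaya algebra -/

namespace LinBimod

/-! ### Bimodules as modules over the enveloping algebra. -/

section Enveloping

variable {C : Type v} {A : Type u} [CommRing C] [Ring A] [Algebra C A]

/-- The `C`-module structure of a `C`-linear `A`-bimodule. -/
instance moduleBase (M : LinBimod.{u, v, w} C A) : Module C M :=
  Module.compHom M (algebraMap C A)

theorem base_smul_def (M : LinBimod.{u, v, w} C A) (c : C) (m : M) :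
    c • m = algebraMap C A c • m := rfl

instance (M : LinBimod.{u, v, w} C A) : IsScalarTower C A M where
  smul_assoc c a m := by rw [Algebra.smul_def, mul_smul, base_smul_def]

instance (M : LinBimod.{u, v, w} C A) : IsScalarTower C Aᵐᵒᵖ M where
  smul_assoc c a m := by
    rw [Algebra.smul_def, mul_smul, base_smul_def, M.central, MulOpposite.algebraMap_apply]

/-- The action of the enveloping algebra on a `C`-linear `A`-bimodule. -/
instance moduleEnveloping (M : LinBimod.{u, v, w} C A) : Module (A ⊗[C] Aᵐᵒᵖ) M :=
  TensorProduct.Algebra.module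

theorem tmul_smul (M : LinBimod.{u, v, w} C A) (a : A) (b : Aᵐᵒᵖ) (m : M) :
    (a ⊗ₜ[C] b) • m = a • b • m :=
  TensorProduct.Algebra.smul_def a b m

/-- On an invariant element right multiplication equals left multiplication, so `a ⊗ b` acts as `a
b`, its value at `1`. -/
theorem enveloping_smul_of_mem_invariants (M : LinBimod.{u, v, w} C A) (t : A ⊗[C] Aᵐᵒᵖ) {m : M}
    (hm : m ∈ M.invariants) : t • m = AlgHom.mulLeftRight C A t 1 • m := by
  induction t with
  | zero =>
    rw [map_zero, LinearMap.zero_apply, zero_smul]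
    exact zero_smul (A ⊗[C] Aᵐᵒᵖ) m
  | tmul a b =>
    rw [tmul_smul, ← op_unop b, ← hm, AlgHom.mulLeftRight_apply, mul_one, mul_smul, unop_op]
  | add s t hs ht => rw [add_smul, hs, ht, map_add, LinearMap.add_apply, add_smul]

theorem smul_tensorObj (N : Type w) [AddCommGroup N] [Module C N] (a : A) (y : N ⊗[C] A) :
    a • (show tensorObj C A N from y) =
      (show tensorObj C A N from (LinearMap.mulLeft C a).lTensor N y) :=
  rfl

theorem op_smul_tensorObj (N : Type w) [AddCommGroup N] [Module C N] (a : A) (y : N ⊗[C] A) :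
    op a • (show tensorObj C A N from y) =
      (show tensorObj C A N from (LinearMap.mulRight C a).lTensor N y) :=
  rfl

theorem enveloping_smul_tensorObj (N : Type w) [AddCommGroup N] [Module C N]
    (t : A ⊗[C] Aᵐᵒᵖ) (y : N ⊗[C] A) :
    t • (show tensorObj C A N from y) =
      (show tensorObj C A N from (AlgHom.mulLeftRight C A t).lTensor N y) := by
  induction t with
  | zero =>
    rw [map_zero, LinearMap.lTensor_zero]
    exact zero_smul (A ⊗[C] Aᵐᵒᵖ) (show tensorObj C A N from y)
  | tmul a b =>
    rw [tmul_smul, ← op_unop b, op_smul_tensorObj, smul_tensorObj, ← LinearMap.lTensor_comp_apply]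
    congr 2
  | add s t hs ht =>
    rw [add_smul, hs, ht, map_add, LinearMap.lTensor_add]
    rfl

end Enveloping

/-- A bijective homomorphism of bimodules is an isomorphism. -/
def isoOfBijective {C : Type v} {A : Type u} [CommRing C] [Ring A] [Algebra C A]
    {M N : LinBimod.{u, v, w} C A} (f : Hom M N) (hf : Function.Bijective f.toAddMonoidHom) :
    M ≅ N where
  hom := f
  inv :=
    { toAddMonoidHom := (AddEquiv.ofBijective f.toAddMonoidHom hf).symm.toAddMonoidHom
      map_left := fun a m => (AddEquiv.ofBijective f.toAddMonoidHom hf).symm_apply_eq.2 (by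
        rw [AddEquiv.ofBijective_apply, f.map_left]
        exact congrArg _ ((AddEquiv.ofBijective _ hf).apply_symm_apply m).symm)
      map_right := fun a m => (AddEquiv.ofBijective f.toAddMonoidHom hf).symm_apply_eq.2 (by
        rw [AddEquiv.ofBijective_apply, f.map_right]
        exact congrArg _ ((AddEquiv.ofBijective _ hf).apply_symm_apply m).symm) }
  hom_inv_id := Hom.ext (AddMonoidHom.ext (AddEquiv.ofBijective _ hf).symm_apply_apply)
  inv_hom_id := Hom.ext (AddMonoidHom.ext (AddEquiv.ofBijective _ hf).apply_symm_apply)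

/-! ### Inverting the unit and the counit. -/

section Azumaya

variable {C : Type v} {A : Type u} [CommRing C] [Ring A] [Algebra C A]

theorem _root_.Module.Projective.exists_dual_basis (C : Type v) (A : Type u) [CommRing C]
    [AddCommGroup A] [Module C A] [Module.Projective C A] [Module.Finite C A] :
    ∃ (n : ℕ) (b : Fin n → A) (φ : Fin n → A →ₗ[C] C), ∀ y, ∑ i, φ i y • b i = y := by
  obtain ⟨n, f, hf⟩ := Module.Finite.exists_fin' C A
  obtain ⟨s, hs⟩ := Module.projective_lifting_property f LinearMap.id hf
  refine ⟨n, fun i => f (Pi.single i 1), fun i => LinearMap.proj i ∘ₗ s, fun y => ?_⟩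
  conv_rhs => rw [← LinearMap.id_apply (R := C) y, ← hs, LinearMap.comp_apply,
    pi_eq_sum_univ' (s y)]
  simp [map_sum]

variable [IsAzumaya C A]

/-- The element of the enveloping algebra acting on `A` as `y ↦ φ y • 1`. -/
def functionalElt (φ : A →ₗ[C] C) : A ⊗[C] Aᵐᵒᵖ :=
  (AlgEquiv.ofBijective (AlgHom.mulLeftRight C A) IsAzumaya.bij).symm (Algebra.linearMap C A ∘ₗ φ)

theorem mulLeftRight_functionalElt (φ : A →ₗ[C] C) :
    AlgHom.mulLeftRight C A (functionalElt φ) = Algebra.linearMap C A ∘ₗ φ :=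
  (AlgEquiv.ofBijective (AlgHom.mulLeftRight C A) IsAzumaya.bij).apply_symm_apply _

/-- On `A` the values `φ y • 1` are central, so `a ⊗ 1` and `1 ⊗ a` agree after `functionalElt φ`.
Injectivity of `A ⊗ Aᵐᵒᵖ → End_C A` makes this an identity in the enveloping algebra, valid on every
bimodule. -/
theorem functionalElt_smul_mem_invariants (M : LinBimod.{u, v, w} C A) (φ : A →ₗ[C] C) (m : M) :
    functionalElt φ • m ∈ M.invariants := fun a => by
  have h : (a ⊗ₜ[C] (1 : Aᵐᵒᵖ)) * functionalElt φ = ((1 : A) ⊗ₜ[C] op a) * functionalElt φ := by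
    apply (IsAzumaya.bij (R := C) (A := A)).1
    rw [map_mul, map_mul, mulLeftRight_functionalElt]
    ext y
    simp [(Algebra.commutes _ a).symm]
  have := congrArg (· • m) h
  simpa only [mul_smul, tmul_smul, one_smul] using this

/-- The dual basis expansion is an identity in `End_C A`; it lifts to the enveloping algebra and so
acts on `M`. -/
theorem sum_smul_functionalElt_smul (M : LinBimod.{u, v, w} C A) {n : ℕ} {b : Fin n → A}
    {φ : Fin n → A →ₗ[C] C} (hb : ∀ y, ∑ i, φ i y • b i = y) (m : M) :
    ∑ i, b i • functionalElt (φ i) • m = m := by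
  have h : ∑ i, (b i ⊗ₜ[C] (1 : Aᵐᵒᵖ)) * functionalElt (φ i) = 1 := by
    apply (IsAzumaya.bij (R := C) (A := A)).1
    ext y
    simp only [map_sum, map_mul, mulLeftRight_functionalElt, map_one, LinearMap.sum_apply]
    conv_rhs => rw [Module.End.one_apply, ← hb y]
    simp [Algebra.smul_def, Algebra.commutes]
  have := congrArg (· • m) h
  simpa only [Finset.sum_smul, mul_smul, tmul_smul, one_smul] using this

theorem functionalElt_smul_smul_of_mem_invariants (M : LinBimod.{u, v, w} C A) (φ : A →ₗ[C] C)
    (a : A) {m : M} (hm : m ∈ M.invariants) :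
    functionalElt φ • a • m = algebraMap C A (φ a) • m := by
  have h : a • m = (a ⊗ₜ[C] (1 : Aᵐᵒᵖ)) • m := by rw [tmul_smul, one_smul]
  rw [h, ← mul_smul, enveloping_smul_of_mem_invariants M _ hm, map_mul,
    mulLeftRight_functionalElt]
  simp

omit [IsAzumaya C A] in
theorem coe_invariants_smul (M : LinBimod.{u, v, w} C A) (c : C) (m : M.invariants) :
    ((c • m : M.invariants) : M) = algebraMap C A c • (m : M) := rfl

/-- The map `M ^ A ⊗ A → M`, `m ⊗ a ↦ a m`. -/
def counitLinearMap (M : LinBimod.{u, v, w} C A) : M.invariants ⊗[C] A →ₗ[C] M :=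
  TensorProduct.lift (LinearMap.mk₂ C (fun m a => a • (m : M))
    (fun m m' a => by simp)
    (fun c m a => by
      rw [coe_invariants_smul, ← base_smul_def, smul_comm])
    (fun m a a' => add_smul a a' _) (fun c m a => smul_assoc c a _))

theorem counitLinearMap_bijective (M : LinBimod.{u, v, w} C A) :
    Function.Bijective (counitLinearMap M) := by
  obtain ⟨n, b, φ, hb⟩ := Module.Projective.exists_dual_basis C A
  let g (i : Fin n) (m : M) : M.invariants :=
    ⟨functionalElt (φ i) • m, functionalElt_smul_mem_invariants M (φ i) m⟩
  -- The inverse of the counit: the "coordinates" of `m` along the dual basis are invariant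
  -- elements.
  let ψ (m : M) : M.invariants ⊗[C] A := ∑ i, g i m ⊗ₜ b i
  have hψ : ∀ t, ψ (counitLinearMap M t) = t := by
    intro t
    induction t with
    | zero =>
      have hg (i) : g i 0 = 0 := Subtype.ext (smul_zero _)
      simp [ψ, hg]
    | tmul m a =>
      have hg (i) : g i (a • (m : M)) = φ i a • m :=
        Subtype.ext (functionalElt_smul_smul_of_mem_invariants M (φ i) a m.2)
      change ∑ i, g i (a • (m : M)) ⊗ₜ b i = m ⊗ₜ a
      conv_rhs => rw [← hb a, TensorProduct.tmul_sum]
      exact Finset.sum_congr rfl fun i _ => by rw [hg, TensorProduct.smul_tmul]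
    | add s t hs ht =>
      have hg (i) (x y : M) : g i (x + y) = g i x + g i y := Subtype.ext (smul_add _ _ _)
      conv_rhs => rw [← hs, ← ht]
      simp [ψ, hg, TensorProduct.add_tmul, Finset.sum_add_distrib]
  refine ⟨Function.LeftInverse.injective hψ, fun m => ⟨ψ m, ?_⟩⟩
  conv_rhs => rw [← sum_smul_functionalElt_smul M hb m]
  exact map_sum _ _ _

/-- The counit `M ^ A ⊗ A → M` as a homomorphism of bimodules. -/
def counitHom (M : LinBimod.{u, v, max u w} C A) :
    Hom (tensorObj.{u, v, max u w} C A M.invariants) M where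
  toAddMonoidHom := (counitLinearMap M).toAddMonoidHom
  map_left a t := by
    change counitLinearMap M ((LinearMap.mulLeft C a).lTensor M.invariants t) =
      a • counitLinearMap M t
    induction t using TensorProduct.induction_on with
    | zero => rw [map_zero, map_zero, smul_zero]
    | tmul m b => exact mul_smul a b (m : M)
    | add s t hs ht => rw [map_add, map_add, map_add, hs, ht, smul_add]
  map_right a t := by
    change counitLinearMap M ((LinearMap.mulRight C a).lTensor M.invariants t) =
      op a • counitLinearMap M t
    induction t using TensorProduct.induction_on with
    | zero => rw [map_zero, map_zero, smul_zero]
    | tmul m b =>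
      change (b * a) • (m : M) = op a • b • (m : M)
      rw [mul_smul, m.2 a, smul_comm]
    | add s t hs ht => rw [map_add, map_add, map_add, hs, ht, smul_add]

omit [IsAzumaya C A] in
theorem counitLinearMap_rTensor {M M' : LinBimod.{u, v, w} C A} (f : Hom M M')
    (g : M.invariants →ₗ[C] M'.invariants) (hg : ∀ m, (g m : M') = f.toAddMonoidHom m)
    (t : M.invariants ⊗[C] A) :
    counitLinearMap M' (g.rTensor A t) = f.toAddMonoidHom (counitLinearMap M t) := by
  induction t using TensorProduct.induction_on with
  | zero => simp only [map_zero]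
  | tmul m b =>
    change b • (g m : M') = f.toAddMonoidHom (b • (m : M))
    rw [hg, f.map_left]
  | add s t hs ht => simp only [map_add, hs, ht]

variable (C A) in
/-- The natural isomorphism `M ^ A ⊗ A ≅ M`. -/
def counitIso : invariantsFunctor.{u, v, max u w} C A ⋙ tensorFunctor.{u, v, w} C A ≅
    𝟭 (LinBimod.{u, v, max u w} C A) :=
  NatIso.ofComponents
    (fun M => isoOfBijective (counitHom.{u, v, w} M) (counitLinearMap_bijective M))
    (fun {M M'} f => Hom.ext (by
      ext t
      exact counitLinearMap_rTensor f ((invariantsFunctor C A).map f).hom (fun _ => rfl) t))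

omit [IsAzumaya C A] in
variable (A) in
/-- The map `N → (N ⊗ A) ^ A`, `n ↦ n ⊗ 1`. -/
def unitLinearMap (N : Type w) [AddCommGroup N] [Module C N] :
    N →ₗ[C] (tensorObj C A N).invariants where
  toFun y := ⟨(y ⊗ₜ[C] (1 : A) : N ⊗[C] A), fun a => by
    change y ⊗ₜ[C] (a * 1) = y ⊗ₜ[C] (1 * a)
    rw [mul_one, one_mul]⟩
  map_add' y z := Subtype.ext (TensorProduct.add_tmul y z 1)
  map_smul' c y := Subtype.ext (by
    change (c • y) ⊗ₜ[C] (1 : A) = y ⊗ₜ[C] (algebraMap C A c * 1)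
    rw [TensorProduct.smul_tmul, Algebra.smul_def])

/-- The retraction `id ⊗ f` gives injectivity. For surjectivity, the enveloping element of `f` fixes
an invariant `t` because `f 1 = 1`, yet it acts as `id ⊗ f` followed by `y ↦ y ⊗ 1`. -/
theorem unitLinearMap_bijective {f : A →ₗ[C] C} (hf : f 1 = 1) (N : Type w) [AddCommGroup N]
    [Module C N] : Function.Bijective (unitLinearMap (C := C) A N) := by
  constructor
  · intro y z h
    have h' : y ⊗ₜ[C] (1 : A) = z ⊗ₜ[C] (1 : A) := congrArg Subtype.val h
    simpa [hf] using congrArg (TensorProduct.rid C N ∘ f.lTensor N) h'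
  · rintro ⟨t, ht⟩
    refine ⟨TensorProduct.rid C N (f.lTensor N t), Subtype.ext ?_⟩
    have h := enveloping_smul_of_mem_invariants _ (functionalElt f) ht
    rw [mulLeftRight_functionalElt, LinearMap.comp_apply, hf, Algebra.linearMap_apply, map_one,
      one_smul] at h
    have h' := enveloping_smul_tensorObj N (functionalElt f) t
    rw [mulLeftRight_functionalElt] at h'
    refine Eq.trans ?_ (h'.symm.trans h)
    change (TensorProduct.rid C N (f.lTensor N t)) ⊗ₜ[C] (1 : A) =
      (Algebra.linearMap C A ∘ₗ f).lTensor N t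
    clear h h' ht
    induction t using TensorProduct.induction_on with
    | zero => simp
    | tmul y a => simp [TensorProduct.smul_tmul, Algebra.algebraMap_eq_smul_one]
    | add s t hs ht => simp only [map_add, TensorProduct.add_tmul, hs, ht]

/-- The natural isomorphism `N ≅ (N ⊗ A) ^ A`. -/
def unitIso {f : A →ₗ[C] C} (hf : f 1 = 1) :
    𝟭 (ModuleCat.{max u w} C) ≅
      tensorFunctor.{u, v, w} C A ⋙ invariantsFunctor.{u, v, max u w} C A :=
  NatIso.ofComponents
    (fun N => (LinearEquiv.ofBijective _ (unitLinearMap_bijective hf N)).toModuleIso)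
    (fun {N N'} g => by ext y; rfl)

/-- Bimodules over an Azumaya algebra in which `C` is a direct summand are equivalent to
`C`-modules. -/
def moritaEquivalence {f : A →ₗ[C] C} (hf : f 1 = 1) :
    ModuleCat.{max u w} C ≌ LinBimod.{u, v, max u w} C A :=
  CategoryTheory.Equivalence.mk (tensorFunctor.{u, v, w} C A)
    (invariantsFunctor.{u, v, max u w} C A) (unitIso hf) (counitIso C A)

end Azumaya

/-! ### Finite generation on both sides. -/

section Finite

variable {C : Type v} {A : Type u} [CommRing C] [Ring A] [Algebra C A]

theorem FG.of_surjective {M N : LinBimod.{u, v, w} C A} (h : M.FG) (f : Hom M N)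
    (hf : Function.Surjective f.toAddMonoidHom) : N.FG := by
  classical
  obtain ⟨S, hS⟩ := h
  refine ⟨S.image f.toAddMonoidHom, top_le_iff.1 ?_⟩
  rw [← AddMonoidHom.range_eq_top.2 hf, AddMonoidHom.range_eq_map, ← hS, AddMonoidHom.map_closure,
    AddSubgroup.closure_le]
  rintro _ ⟨_, ⟨a, b, s, hs, rfl⟩, rfl⟩
  exact AddSubgroup.subset_closure
    ⟨a, b, _, Finset.mem_image_of_mem _ hs, by rw [f.map_left, f.map_right]⟩

theorem fg_iff_of_bijective {M N : LinBimod.{u, v, w} C A} (f : Hom M N)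
    (hf : Function.Bijective f.toAddMonoidHom) : M.FG ↔ N.FG :=
  ⟨fun h => h.of_surjective f hf.2, fun h => h.of_surjective (isoOfBijective f hf).inv
    (AddEquiv.ofBijective _ hf).symm.surjective⟩

theorem tensorObj_fg (N : Type w) [AddCommGroup N] [Module C N] [Module.Finite C N] :
    (tensorObj C A N).FG := by
  classical
  obtain ⟨S, hS⟩ := Module.Finite.fg_top (R := C) (M := N)
  refine ⟨S.image fun y => (y ⊗ₜ[C] (1 : A) : N ⊗[C] A), ?_⟩
  set K := AddSubgroup.closure {m : tensorObj C A N | ∃ a b : A,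
    ∃ s ∈ S.image fun y => (y ⊗ₜ[C] (1 : A) : N ⊗[C] A),
      m = a • (op b • (show tensorObj C A N from s))}
  have key (y : N) : ∀ a : A, (show tensorObj C A N from y ⊗ₜ[C] a) ∈ K := by
    have hy : y ∈ Submodule.span C (S : Set N) := hS ▸ Submodule.mem_top
    induction hy using Submodule.span_induction with
    | mem y hy =>
      intro a
      refine AddSubgroup.subset_closure ⟨a, 1, _, Finset.mem_image_of_mem _ hy, ?_⟩
      change y ⊗ₜ[C] a = y ⊗ₜ[C] (a * (1 * 1))
      rw [mul_one, mul_one]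
    | zero => exact fun a => (TensorProduct.zero_tmul N a : (0 : N) ⊗ₜ[C] a = 0) ▸ K.zero_mem
    | add y z _ _ hy hz =>
      exact fun a =>
        (TensorProduct.add_tmul y z a : (y + z) ⊗ₜ[C] a = y ⊗ₜ[C] a + z ⊗ₜ[C] a) ▸ K.add_mem (hy a) (hz a)
    | smul c y _ hy => exact fun a => 
        (TensorProduct.smul_tmul c y a : (c • y) ⊗ₜ[C] a = y ⊗ₜ[C] (c • a)) ▸ hy (c • a)
  refine (AddSubgroup.eq_top_iff' K).2 fun t => ?_
  induction t using TensorProduct.induction_on with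
  | zero => exact K.zero_mem
  | tmul y a => exact key y a
  | add s t hs ht => exact K.add_mem hs ht

/-- Finitely many bimodule generators come from `N' ⊗ A` with `N'` a finitely generated submodule.
The image of `N' ⊗ A` is a sub-bimodule, hence everything, and applying `id ⊗ f` to `y ⊗ 1` puts
each `y` in `N'`. -/
theorem FG.finite_of_tensorObj {f : A →ₗ[C] C} (hf : f 1 = 1) {N : Type w} [AddCommGroup N]
    [Module C N] (h : (tensorObj C A N).FG) : Module.Finite C N := by
  obtain ⟨S, hS⟩ := h
  obtain ⟨N', hN', hSN'⟩ := TensorProduct.exists_finite_submodule_left_of_setFinite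
    (R := C) (M := N) (N := A) {s : N ⊗[C] A | (show tensorObj C A N from s) ∈ S} S.finite_toSet
  have hstable (T : Module.End C A) {t : N ⊗[C] A}
      (ht : t ∈ LinearMap.range (N'.subtype.rTensor A)) :
      T.lTensor N t ∈ LinearMap.range (N'.subtype.rTensor A) := by
    obtain ⟨t', rfl⟩ := ht
    refine ⟨T.lTensor N' t', ?_⟩
    rw [← LinearMap.comp_apply, ← LinearMap.comp_apply, LinearMap.rTensor_comp_lTensor,
      LinearMap.lTensor_comp_rTensor]
  have htop (t : N ⊗[C] A) : t ∈ LinearMap.range (N'.subtype.rTensor A) := by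
    have hle : (⊤ : AddSubgroup (tensorObj C A N)) ≤
        (show AddSubgroup (tensorObj C A N) from
          (LinearMap.range (N'.subtype.rTensor A)).toAddSubgroup) := by
      rw [← hS, AddSubgroup.closure_le]
      rintro _ ⟨a, b, s, hs, rfl⟩
      exact hstable (LinearMap.mulLeft C a) (hstable (LinearMap.mulRight C b) (hSN' hs))
    exact hle (AddSubgroup.mem_top t)
  have hN'top : N' = ⊤ := by
    refine (Submodule.eq_top_iff').2 fun y => ?_
    obtain ⟨t', ht'⟩ := htop (y ⊗ₜ 1)
    have h1 := congrArg (TensorProduct.rid C N ∘ f.lTensor N) ht'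
    simp only [Function.comp_apply, LinearMap.lTensor_tmul, hf, TensorProduct.rid_tmul,
      one_smul] at h1
    rw [← h1]
    clear h1 ht'
    induction t' with
    | zero => simp
    | tmul z a => simpa using N'.smul_mem _ z.2
    | add s t hs ht => simpa only [map_add] using N'.add_mem hs ht
  exact ⟨hN'top ▸ Module.Finite.iff_fg.1 hN'⟩

theorem tensorObj_fg_iff {f : A →ₗ[C] C} (hf : f 1 = 1) (N : Type w) [AddCommGroup N]
    [Module C N] : Module.Finite C N ↔ (tensorObj C A N).FG :=
  ⟨fun _ => tensorObj_fg N, FG.finite_of_tensorObj hf⟩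

theorem fg_iff_finite_invariants [IsAzumaya C A] {f : A →ₗ[C] C} (hf : f 1 = 1)
    (M : LinBimod.{u, v, max u w} C A) : M.FG ↔ Module.Finite C M.invariants :=
  (fg_iff_of_bijective (counitHom.{u, v, w} M) (counitLinearMap_bijective M)).symm.trans
    (tensorObj_fg_iff hf _).symm

end Finite

end LinBimod

/-! ### The Weyl algebra over its center -/

namespace WeylAlgebra

variable (R : Type u) [CommRing R] (n p : ℕ) [CharP R p]

theorem algebraMap_pSubalgebra_injective :
    Function.Injective (algebraMap (pSubalgebra R n p) (WeylAlgebra R n)) :=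
  Subtype.val_injective

theorem natCast_pSubalgebra : (p : pSubalgebra R n p) = 0 :=
  algebraMap_pSubalgebra_injective R n p (by rw [map_natCast, map_zero, natCast_char])

theorem x_pow_mem_range (i : Fin n) :
    (x R i : WeylAlgebra R n) ^ p ∈ (algebraMap (pSubalgebra R n p) (WeylAlgebra R n)).range :=
  ⟨⟨_, Algebra.subset_adjoin (.inl ⟨i, rfl⟩)⟩, rfl⟩

theorem d_pow_mem_range (i : Fin n) :
    (d R i : WeylAlgebra R n) ^ p ∈ (algebraMap (pSubalgebra R n p) (WeylAlgebra R n)).range :=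
  ⟨⟨_, Algebra.subset_adjoin (.inr ⟨i, rfl⟩)⟩, rfl⟩

theorem adjoin_pSubalgebra_generators :
    Algebra.adjoin (pSubalgebra R n p)
      (Set.range (x R : Fin n → WeylAlgebra R n) ∪ Set.range (d R)) = ⊤ := by
  refine Algebra.eq_top_iff.2 fun a => ?_
  have ha : a ∈ Algebra.adjoin R
      (Set.range (x R : Fin n → WeylAlgebra R n) ∪ Set.range (d R)) := by
    rw [adjoin_generators]
    trivial
  induction ha using Algebra.adjoin_induction with
  | mem a ha => exact Algebra.subset_adjoin ha
  | algebraMap r => exact Subalgebra.algebraMap_mem _ (algebraMap R (pSubalgebra R n p) r)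
  | add a b _ _ ha hb => exact add_mem ha hb
  | mul a b _ _ ha hb => exact mul_mem ha hb

variable {p}

/-- The basis of the reduced monomials `x ^ α ∂ ^ β` over `C`. -/
def monomialBasis (hp : p.Prime) :
    Module.Basis ((Fin n → Fin p) × (Fin n → Fin p)) (pSubalgebra R n p) (WeylAlgebra R n) :=
  Module.Basis.mk
    ((isWeylTuple R n).linearIndependent_reducedMonomial hp (natCast_pSubalgebra R n p)
      (algebraMap_pSubalgebra_injective R n p))
    ((isWeylTuple R n).span_reducedMonomial hp.pos (x_pow_mem_range R n p)
      (d_pow_mem_range R n p) (adjoin_pSubalgebra_generators R n p)).ge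

theorem monomialBasis_apply (hp : p.Prime) (w : (Fin n → Fin p) × (Fin n → Fin p)) :
    monomialBasis R n hp w = reducedMonomial p (x R) (d R) w := by
  simp [monomialBasis]

theorem isAzumaya (hp : p.Prime) : IsAzumaya (pSubalgebra R n p) (WeylAlgebra R n) :=
  (isWeylTuple R n).isAzumaya hp (natCast_pSubalgebra R n p)
    (algebraMap_pSubalgebra_injective R n p) (monomialBasis R n hp) (monomialBasis_apply R n hp)

theorem center_eq_pSubalgebra (hp : p.Prime) :
    Subalgebra.center R (WeylAlgebra R n) = pSubalgebra R n p := by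
  refine le_antisymm (fun z hz => ?_) (pSubalgebra_le_center R n p)
  have := isAzumaya R n hp
  have := Module.Free.of_basis (monomialBasis R n hp)
  have hz' : z ∈ Subalgebra.center (pSubalgebra R n p) (WeylAlgebra R n) :=
    Subalgebra.mem_center_iff.2 (Subalgebra.mem_center_iff.1 hz)
  obtain ⟨c, rfl⟩ := Algebra.mem_bot.1 (Algebra.IsCentral.out hz')
  exact c.2

/-- The element `1` is the basis monomial with all exponents zero, so its coordinate function splits
`C → A`. -/
theorem exists_retraction (hp : p.Prime) :
    ∃ f : WeylAlgebra R n →ₗ[pSubalgebra R n p] pSubalgebra R n p, f 1 = 1 := by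
  let w₀ : (Fin n → Fin p) × (Fin n → Fin p) := (fun _ => ⟨0, hp.pos⟩, fun _ => ⟨0, hp.pos⟩)
  refine ⟨(monomialBasis R n hp).coord w₀, ?_⟩
  have h : monomialBasis R n hp w₀ = 1 := by
    have hz (a : Fin n → WeylAlgebra R n) : tuplePow a (fun _ => 0) = 1 := tuplePow_zero
    simp [monomialBasis_apply, reducedMonomial, w₀, hz]
  rw [← h]
  simp

end WeylAlgebra

end

theorem theorem2p3 {R : Type u} [CommRing R] (p : ℕ) (hp : p.Prime) [CharP R p] (n : ℕ) :
    -- (i) the center of `A_n(R)` is `C`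
    Subalgebra.center R (WeylAlgebra R n) = WeylAlgebra.pSubalgebra R n p ∧
    -- (ii) the reduced monomials in any tuple satisfying the Weyl relations form a `C`-basis
    (∀ Q P : Fin n → WeylAlgebra R n, IsWeylTuple Q P →
      ∃ b : Module.Basis ((Fin n → Fin p) × (Fin n → Fin p))
          (WeylAlgebra.pSubalgebra R n p) (WeylAlgebra R n),
        ∀ α β : Fin n → Fin p,
          b (α, β) = tuplePow Q (fun i => (α i : ℕ)) * tuplePow P (fun i => (β i : ℕ))) ∧
    -- (iii) `A_n(R)` is Azumaya over `C`
    IsAzumaya (WeylAlgebra.pSubalgebra R n p) (WeylAlgebra R n) ∧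
    -- `N ↦ N ⊗ A` is an equivalence with inverse `M ↦ M ^ A`
    (∃ e : ModuleCat.{max u w} (WeylAlgebra.pSubalgebra R n p) ≌
        LinBimod.{u, u, max u w} (WeylAlgebra.pSubalgebra R n p) (WeylAlgebra R n),
      e.functor = LinBimod.tensorFunctor.{u, u, w} (WeylAlgebra.pSubalgebra R n p)
        (WeylAlgebra R n) ∧
      e.inverse = LinBimod.invariantsFunctor.{u, u, max u w} (WeylAlgebra.pSubalgebra R n p)
        (WeylAlgebra R n)) ∧
    -- which preserves finite generation, in both directions
    (∀ N : ModuleCat.{max u w} (WeylAlgebra.pSubalgebra R n p),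
      Module.Finite (WeylAlgebra.pSubalgebra R n p) N ↔
        ((LinBimod.tensorFunctor.{u, u, w} (WeylAlgebra.pSubalgebra R n p)
          (WeylAlgebra R n)).obj N).FG) ∧
    (∀ M : LinBimod.{u, u, max u w} (WeylAlgebra.pSubalgebra R n p) (WeylAlgebra R n),
      M.FG ↔ Module.Finite (WeylAlgebra.pSubalgebra R n p)
        ((LinBimod.invariantsFunctor.{u, u, max u w} (WeylAlgebra.pSubalgebra R n p)
          (WeylAlgebra R n)).obj M)) := by
  have := WeylAlgebra.isAzumaya R n hp
  obtain ⟨f, hf⟩ := WeylAlgebra.exists_retraction R n hp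
  exact ⟨WeylAlgebra.center_eq_pSubalgebra R n hp,
    fun Q P h => ⟨h.basis hp (WeylAlgebra.natCast_pSubalgebra R n p)
      (WeylAlgebra.monomialBasis R n hp), fun α β => h.basis_apply hp _ _ (α, β)⟩,
    -- `CategoryTheory.Equivalence.mk` may adjust the unit to obtain the triangle identities, but it
    -- keeps both functors.
    this, ⟨LinBimod.moritaEquivalence.{u, u, w} hf, rfl, rfl⟩,
    fun N => LinBimod.tensorObj_fg_iff hf N,
    fun M => LinBimod.fg_iff_finite_invariants.{u, u, w} hf M⟩
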